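/- Let $n\ge 1$ and let $(M^{2n+1},\eta)$ be a contact manifold: $M$ is a smooth manifold of dimension $2n+1$ and $\eta$ is a smooth $1$-form with $\eta\wedge(d\eta)^n\neq 0$ at every point. Let $D=\ker\eta$ be the contact distribution. Let $(\phi,\xi,\eta,g)$ be an almost contact metric structure on $M$, i.e. $\phi$ is a smooth $(1,1)$-tensor field, $\xi$ a smooth vector field and $g$ a Riemannian metric such that $$\phi^2=-I+\eta\otimes\xi,\qquad \eta(\xi)=1,\qquad g(\phi X,\phi Y)=g(X,Y)-\eta(X)\eta(Y)$$ for all vector fields $X,Y$ (it is not assumed that $d\eta(X,Y)=g(X,\phi Y)$, nor that $\xi$ is the Reeb field of $\eta$). Let $\nabla$ be the Levi-Civita connection of $g$, and suppose that $$d\eta(\phi X,\phi Y)=-d\eta(X,Y),\qquad g((\nabla_X\phi)Y,Z)=0$$ for all smooth sections $X,Y,Z$ of $D$. If there is a point $p\in M$ such that the sectional curvature $K_p(\pi)$ of $g$ vanishes for every $2$-plane $\pi\subseteq D_p$, then $\dim M=5$. -/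

import Mathlib

open Bundle
open scoped Manifold ContDiff Bundle

noncomputable section

namespace ContactMetric

section Forms

variable {E : Type*} [NormedAddCommGroup E] [NormedSpace ℝ E]
  {H : Type*} [TopologicalSpace H] (I : ModelWithCorners ℝ E H)
  {M : Type*} [TopologicalSpace M] [ChartedSpace H M] [IsManifold I ∞ M]

/-- `X` is a smooth (global) vector field on `M`, i.e. `X ∈ 𝔛(M)`. -/
def IsSmoothField (X : Π x : M, TangentSpace I x) : Prop :=
  ContMDiff I I.tangent ∞ (fun x ↦ (TotalSpace.mk' E x (X x) : TangentBundle I M))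

/-- `η` is a smooth `1`-form on `M`. -/
def IsSmoothOneForm (η : Π x : M, TangentSpace I x →L[ℝ] ℝ) : Prop :=
  ContMDiff I (I.prod 𝓘(ℝ, E →L[ℝ] ℝ)) ∞
    (fun x ↦ TotalSpace.mk' (E →L[ℝ] ℝ) (E := fun x : M ↦ TangentSpace I x →L[ℝ] ℝ) x (η x))

/-- `φ` is a smooth tensor field of type `(1,1)` on `M`. -/
def IsSmoothEndomorphism (φ : Π x : M, TangentSpace I x →L[ℝ] TangentSpace I x) : Prop :=
  ContMDiff I (I.prod 𝓘(ℝ, E →L[ℝ] E)) ∞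
    (fun x ↦ TotalSpace.mk' (E →L[ℝ] E)
      (E := fun x : M ↦ TangentSpace I x →L[ℝ] TangentSpace I x) x (φ x))

/-- `X` is a smooth section of the distribution `D = ker η`. -/
def IsHorizontalField (η : Π x : M, TangentSpace I x →L[ℝ] ℝ)
    (X : Π x : M, TangentSpace I x) : Prop :=
  IsSmoothField I X ∧ ∀ x, η x (X x) = 0

/-- The exterior derivative of the `1`-form `η`, evaluated on two vector fields, with the
normalization `2 dη(X, Y) = X(η(Y)) - Y(η(X)) - η([X, Y])`. -/
def extDerivOneForm (η : Π x : M, TangentSpace I x →L[ℝ] ℝ)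
    (X Y : Π x : M, TangentSpace I x) (x : M) : ℝ :=
  (1 / 2 : ℝ) * (mvfderiv I (fun y ↦ η y (Y y)) x (X x) - mvfderiv I (fun y ↦ η y (X y)) x (Y x)
    - η x (VectorField.mlieBracket I X Y x))

/-- The `(2n+1)`-form `η ∧ (dη)^n`, evaluated on `2n+1` vector fields: the alternation of
`η ⊗ dη ⊗ ⋯ ⊗ dη` (with `n` factors `dη`). -/
def wedgeExtDerivPow (η : Π x : M, TangentSpace I x →L[ℝ] ℝ) (n : ℕ)
    (X : Fin (2 * n + 1) → Π x : M, TangentSpace I x) (x : M) : ℝ :=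
  ((Nat.factorial (2 * n + 1) : ℝ))⁻¹ *
    ∑ σ : Equiv.Perm (Fin (2 * n + 1)), ((Equiv.Perm.sign σ : ℤ) : ℝ) *
      (η x (X (σ 0) x) *
        ∏ i : Fin n, extDerivOneForm I η (X (σ ⟨2 * i + 1, by omega⟩))
          (X (σ ⟨2 * i + 2, by omega⟩)) x)

/-- `η` is a contact form on the `(2n+1)`-dimensional manifold `M`: a smooth `1`-form such that
`η ∧ (dη)^n` vanishes at no point. -/
structure IsContactForm (η : Π x : M, TangentSpace I x →L[ℝ] ℝ) (n : ℕ) : Prop where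
  smooth : IsSmoothOneForm I η
  nonvanishing : ∀ x : M, ∃ X : Fin (2 * n + 1) → Π y : M, TangentSpace I y,
    (∀ i, IsSmoothField I (X i)) ∧ wedgeExtDerivPow I η n X x ≠ 0

end Forms

section Metric

variable {E : Type*} [NormedAddCommGroup E] [NormedSpace ℝ E] [FiniteDimensional ℝ E]
  {H : Type*} [TopologicalSpace H] (I : ModelWithCorners ℝ E H)
  {M : Type*} [TopologicalSpace M] [ChartedSpace H M] [IsManifold I ∞ M]
  [RiemannianBundle (fun x : M ↦ TangentSpace I x)]
  [IsContMDiffRiemannianBundle I ∞ E (fun x : M ↦ TangentSpace I x)]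

/-- `(φ, ξ, η, g)` is an almost contact metric structure on `M`, where `g` is the
Riemannian metric of `M`. -/
structure IsAlmostContactMetric (φ : Π x : M, TangentSpace I x →L[ℝ] TangentSpace I x)
    (ξ : Π x : M, TangentSpace I x) (η : Π x : M, TangentSpace I x →L[ℝ] ℝ) : Prop where
  smooth_phi : IsSmoothEndomorphism I φ
  smooth_xi : IsSmoothField I ξ
  smooth_eta : IsSmoothOneForm I η
  phi_phi : ∀ (x : M) (v : TangentSpace I x), φ x (φ x v) = -v + η x v • ξ x
  eta_xi : ∀ x : M, η x (ξ x) = 1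
  inner_phi_phi : ∀ (x : M) (u v : TangentSpace I x),
    inner ℝ (φ x u) (φ x v) = inner ℝ u v - η x u * η x v

variable {I}

/-- `nabla` is the Levi-Civita connection of the Riemannian metric `g` of `M`: it is torsion free,
and `X g(Y, Z) = g(∇_X Y, Z) + g(Y, ∇_X Z)` for differentiable vector fields. -/
structure IsLeviCivita (nabla : CovariantDerivative I E (fun x : M ↦ TangentSpace I x)) :
    Prop where
  torsion_eq_zero : nabla.torsion = 0
  metric : ∀ (X Y Z : Π x : M, TangentSpace I x) (x : M),
    MDifferentiableAt I I.tangent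
      (fun y ↦ (TotalSpace.mk' E y (Y y) : TangentBundle I M)) x →
    MDifferentiableAt I I.tangent
      (fun y ↦ (TotalSpace.mk' E y (Z y) : TangentBundle I M)) x →
    mvfderiv I (fun y ↦ (inner ℝ (Y y) (Z y) : ℝ)) x (X x)
      = inner ℝ (nabla Y x (X x)) (Z x) + inner ℝ (Y x) (nabla Z x (X x))

/-- The vector field `∇_X Y`. -/
def covD (nabla : CovariantDerivative I E (fun x : M ↦ TangentSpace I x))
    (X Y : Π x : M, TangentSpace I x) (x : M) : TangentSpace I x :=
  nabla Y x (X x)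

/-- The vector field `(∇_X φ) Y = ∇_X (φ Y) - φ (∇_X Y)`. -/
def covDEndomorphism (nabla : CovariantDerivative I E (fun x : M ↦ TangentSpace I x))
    (φ : Π x : M, TangentSpace I x →L[ℝ] TangentSpace I x)
    (X Y : Π x : M, TangentSpace I x) (x : M) : TangentSpace I x :=
  covD nabla X (fun y ↦ φ y (Y y)) x - φ x (covD nabla X Y x)

/-- The curvature `R(X, Y) Z = ∇_X ∇_Y Z - ∇_Y ∇_X Z - ∇_[X, Y] Z`. -/
def curvature (nabla : CovariantDerivative I E (fun x : M ↦ TangentSpace I x))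
    (X Y Z : Π x : M, TangentSpace I x) (x : M) : TangentSpace I x :=
  covD nabla X (covD nabla Y Z) x - covD nabla Y (covD nabla X Z) x
    - covD nabla (VectorField.mlieBracket I X Y) Z x

/-- The sectional curvature at `x` of the `2`-plane spanned by `X x` and `Y x`, for vector fields
`X`, `Y` linearly independent at `x`. -/
def sectionalCurvature (nabla : CovariantDerivative I E (fun x : M ↦ TangentSpace I x))
    (X Y : Π x : M, TangentSpace I x) (x : M) : ℝ :=
  inner ℝ (curvature nabla X Y Y x) (X x) /
    (inner ℝ (X x) (X x) * inner ℝ (Y x) (Y x) - inner ℝ (X x) (Y x) ^ 2)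

/-- All horizontal sectional curvatures vanish at `p`: every `2`-plane `π ⊆ D_p = ker η_p` has
`K_p(π) = 0`. The plane is given as the span of the values at `p` of two smooth vector fields;
`K_p(π)` does not depend on the fields chosen. -/
def HorizontallyFlatAt (nabla : CovariantDerivative I E (fun x : M ↦ TangentSpace I x))
    (η : Π x : M, TangentSpace I x →L[ℝ] ℝ) (p : M) : Prop :=
  ∀ X Y : Π x : M, TangentSpace I x, IsSmoothField I X → IsSmoothField I Y →
    η p (X p) = 0 → η p (Y p) = 0 → LinearIndependent ℝ ![X p, Y p] →
    sectionalCurvature nabla X Y p = 0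

end Metric

end ContactMetric

end

open ContactMetric

section LinearAlgebra

open Module

variable {W : Type*} [NormedAddCommGroup W] [InnerProductSpace ℝ W]

/-- A quadrilinear function with the symmetries of a curvature tensor vanishes as soon as all its
sectional values vanish. -/
theorem eq_zero_of_curvature_symmetries {V : Type*} [AddCommGroup V] (R : V → V → V → V → ℝ)
    (add_left : ∀ a a' b c d, R (a + a') b c d = R a b c d + R a' b c d)
    (add_right : ∀ a b c d d', R a b c (d + d') = R a b c d + R a b c d')
    (skew : ∀ a b c d, R a b c d = -R b a c d)
    (skew' : ∀ a b c d, R a b c d = -R a b d c)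
    (bianchi : ∀ a b c d, R a b c d + R b c a d + R c a b d = 0)
    (sec : ∀ a b, R a b b a = 0) (a b c d : V) : R a b c d = 0 := by
  have pair : ∀ a b c d, R a b c d = R c d a b := by
    intro a b c d
    have e1 := bianchi a b c d
    have e2 := bianchi b c d a
    have e3 := bianchi c d a b
    have e4 := bianchi d a b c
    have s1 := skew' b c d a
    have s2 := skew' c d b a
    have s7 := skew' d a c b
    have s9 := skew c a b d
    have s10 := skew' a c b d
    have s11 := skew' a b c d
    have s12 := skew' d b a c
    have s13 := skew b d a c
    linarith
  have add_mid : ∀ a b c c' d, R a b (c + c') d = R a b c d + R a b c' d := by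
    intro a b c c' d
    rw [skew' a b (c + c') d, add_right, skew' a b c d, skew' a b c' d]; ring
  have add_snd : ∀ a b b' c d, R a (b + b') c d = R a b c d + R a b' c d := by
    intro a b b' c d
    rw [skew a (b + b') c d, add_left, skew a b c d, skew a b' c d]; ring
  have h1 : ∀ u v w, R u v w u = 0 := by
    intro u v w
    have e := sec u (v + w)
    rw [add_snd, add_mid, add_mid, sec, sec] at e
    have e2 := pair u w v u
    have e3 := skew v u u w
    have e4 := skew' u v u w
    linarith
  have h2 : ∀ u v w z, R u v w z = -R z v w u := by
    intro u v w z
    have e := h1 (u + z) v w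
    rw [add_left, add_right, add_right, h1, h1] at e
    linarith
  have e1 := bianchi a b c d
  have : R b c a d = R a b c d := by
    have i1 := h2 b c a d
    have i2 := skew d c a b
    have i3 := pair c d a b
    linarith
  have : R c a b d = R a b c d := by
    have i6 := h2 c a b d
    have i7 := skew a b c d
    have i8 := h2 b a c d
    have i9 := skew' d a c b
    linarith
  linarith

theorem finrank_span_range_le {ι : Type*} [Fintype ι] (v : ι → W) :
    finrank ℝ (Submodule.span ℝ (Set.range v)) ≤ Fintype.card ι :=
  finrank_range_le_card (R := ℝ) (b := v)

section ComplexStructure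

variable (J A : W →ₗ[ℝ] W) (S : W → W)
  (JJ : ∀ x, J (J x) = -x) (inner_J : ∀ x y, inner ℝ (J x) (J y) = inner ℝ x y)
  (h : ∀ x y z, inner ℝ (J (A y)) z • A x - inner ℝ (J (A x)) z • A y
    + inner ℝ (A y) z • J (A x) - inner ℝ (A x) z • J (A y)
      = (inner ℝ (A x) y - inner ℝ x (A y)) • S z)
  (nondeg : ∀ x, (∀ y, inner ℝ (A x) y - inner ℝ x (A y) = 0) → x = 0)

include JJ inner_J in
theorem inner_complexStructure_self (x : W) : inner ℝ (J x) x = 0 := by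
  have e := inner_J (J x) x
  rw [JJ, inner_neg_left, real_inner_comm] at e
  linarith

include JJ inner_J h nondeg in
theorem finrank_le_four_of_eq_zero [FiniteDimensional ℝ W] (hS : ∀ z, S z = 0) :
    finrank ℝ W ≤ 4 := by
  by_cases hA : ∀ x, A x = 0
  · have : Subsingleton W := subsingleton_of_forall_eq 0 fun x ↦ nondeg x fun y ↦ by simp [hA]
    rw [finrank_zero_of_subsingleton]
    norm_num
  push Not at hA
  obtain ⟨x₀, hx₀⟩ := hA
  set a := A x₀ with ha
  let P := Submodule.span ℝ (Set.range ![a, J a])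
  have memP : ∀ s t : ℝ, s • a + t • J a ∈ P := fun s t ↦
    P.add_mem (P.smul_mem _ (Submodule.subset_span ⟨0, rfl⟩))
      (P.smul_mem _ (Submodule.subset_span ⟨1, rfl⟩))
  have hN : inner ℝ a a ≠ 0 := inner_self_ne_zero.2 hx₀
  have hAP : ∀ y, A y ∈ P := by
    intro y
    have e := h x₀ y a
    rw [hS, smul_zero, ← ha, inner_complexStructure_self J JJ inner_J a, zero_smul, sub_zero] at e
    have e2 : J (A y) = (inner ℝ (J (A y)) a / inner ℝ a a) • a
        + (inner ℝ (A y) a / inner ℝ a a) • J a := by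
      rw [sub_eq_zero] at e
      rw [div_eq_inv_mul, div_eq_inv_mul, mul_smul, mul_smul, ← smul_add, e, smul_smul,
        inv_mul_cancel₀ hN, one_smul]
    have e3 := congrArg J e2
    rw [JJ, map_add, map_smul, map_smul, JJ] at e3
    have e4 : A y = (inner ℝ (A y) a / inner ℝ a a) • a
        + (-(inner ℝ (J (A y)) a / inner ℝ a a)) • J a := by
      calc A y = -(-A y) := (neg_neg _).symm
        _ = _ := by rw [e3]; module
    rw [e4]
    exact memP _ _
  let L : W →ₗ[ℝ] P × P := (A.codRestrict P hAP).prod P.orthogonalProjectionOnto.toLinearMap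
  have hL : Function.Injective L := by
    rw [← LinearMap.ker_eq_bot, LinearMap.ker_eq_bot']
    intro x hx
    have hx1 : A x = 0 := congrArg (fun q : P × P ↦ (q.1 : W)) hx
    have hx2 : P.orthogonalProjectionOnto x = 0 := congrArg Prod.snd hx
    rw [Submodule.orthogonalProjectionOnto_eq_zero_iff] at hx2
    refine nondeg x fun y ↦ ?_
    rw [hx1, inner_zero_left, real_inner_comm, hx2 _ (hAP y), sub_zero]
  have := LinearMap.finrank_le_finrank_of_injective hL
  have h2 : finrank ℝ P ≤ 2 := finrank_span_range_le _
  rw [finrank_prod] at this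
  omega

include JJ inner_J h nondeg in
theorem finrank_le_four_of_ne_zero [FiniteDimensional ℝ W] (z₀ : W) (hS : S z₀ ≠ 0) :
    finrank ℝ W ≤ 4 := by
  have hex : ∀ x, x ≠ 0 → ∃ y, inner ℝ (A x) y - inner ℝ x (A y) ≠ 0 := by
    intro x hx
    by_contra! hc
    exact hx (nondeg x hc)
  have hinj : ∀ x, A x = 0 → x = 0 := by
    intro x hx
    by_contra hne
    obtain ⟨y, hy⟩ := hex x hne
    have e := h x y z₀
    rw [hx] at e
    simp only [map_zero, smul_zero, inner_zero_left, zero_smul, sub_zero, add_zero] at e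
    rw [hx, inner_zero_left] at hy
    exact (smul_ne_zero hy hS) e.symm
  obtain ⟨y₁, hy₁⟩ := hex _ hS
  set a := A (S z₀) with ha
  set b := A y₁ with hb
  let P := Submodule.span ℝ (Set.range ![a, J a, b, J b])
  have m0 : a ∈ P := Submodule.subset_span ⟨0, rfl⟩
  have m1 : J a ∈ P := Submodule.subset_span ⟨1, rfl⟩
  have m2 : b ∈ P := Submodule.subset_span ⟨2, rfl⟩
  have m3 : J b ∈ P := Submodule.subset_span ⟨3, rfl⟩
  have hSP : ∀ z, S z ∈ P := by
    intro z
    have e := h (S z₀) y₁ z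
    rw [← P.smul_mem_iff hy₁, ← e]
    exact P.sub_mem (P.add_mem (P.sub_mem (P.smul_mem _ m0) (P.smul_mem _ m2)) (P.smul_mem _ m1))
      (P.smul_mem _ m3)
  have hJP : ∀ x ∈ P, J x ∈ P := by
    intro x hx
    induction hx using Submodule.span_induction with
    | mem x hx =>
      obtain ⟨i, rfl⟩ := hx
      fin_cases i
      · exact m1
      · simpa [JJ] using m0
      · exact m3
      · simpa [JJ] using m2
    | zero => simp
    | add x y _ _ hx hy => rw [map_add]; exact P.add_mem hx hy
    | smul c x _ hx => rw [map_smul]; exact P.smul_mem _ hx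
  have hAP : ∀ x, A x ∈ P := by
    intro x
    by_cases hx : x = 0
    · simp [hx]
    obtain ⟨y, hy⟩ := hex x hx
    have hN : inner ℝ (A x) (A x) ≠ 0 := inner_self_ne_zero.2 fun h0 ↦ hx (hinj x h0)
    have hJ0 := inner_complexStructure_self J JJ inner_J (A x)
    have hJ0' : inner ℝ (A x) (J (A x)) = 0 := by rw [real_inner_comm]; exact hJ0
    have hJJ : inner ℝ (J (A x)) (J (A x)) = inner ℝ (A x) (A x) := inner_J _ _
    obtain ⟨s, hs⟩ : ∃ s, s = inner ℝ (A x) (A y) / inner ℝ (A x) (A x) := ⟨_, rfl⟩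
    obtain ⟨t, ht⟩ : ∃ t, t = inner ℝ (J (A x)) (A y) / inner ℝ (A x) (A x) := ⟨_, rfl⟩
    rw [eq_div_iff hN] at hs ht
    obtain ⟨b', hb'⟩ : ∃ b', b' = A y - s • A x - t • J (A x) := ⟨_, rfl⟩
    have hAy : A y = b' + s • A x + t • J (A x) := by rw [hb']; module
    have o1 : inner ℝ (A x) b' = 0 := by
      rw [hb', inner_sub_right, inner_sub_right, inner_smul_right, inner_smul_right, hJ0']
      linarith
    have o2 : inner ℝ (J (A x)) b' = 0 := by
      rw [hb', inner_sub_right, inner_sub_right, inner_smul_right, inner_smul_right, hJ0, hJJ]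
      linarith
    have hJAy : J (A y) = J b' + s • J (A x) - t • A x := by
      rw [hAy]; simp only [map_add, map_smul, JJ]; module
    have hb'0 : b' ≠ 0 := by
      intro h0
      have e := h x y z₀
      refine smul_ne_zero hy hS (e.symm.trans ?_)
      rw [hJAy, hAy, h0]
      simp only [map_zero, inner_add_left, inner_sub_left, inner_smul_left, zero_add, conj_trivial]
      module
    have e := h x y b'
    rw [hJAy, hAy, o1, o2, inner_add_left, inner_add_left, inner_sub_left, inner_add_left,
      inner_smul_left, inner_smul_left, inner_smul_left, inner_smul_left, o1, o2,
      inner_complexStructure_self J JJ inner_J b'] at e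
    simp only [mul_zero, add_zero, sub_zero, zero_smul, zero_add] at e
    have m : inner ℝ b' b' • J (A x) ∈ P := by rw [e]; exact P.smul_mem _ (hSP _)
    rw [P.smul_mem_iff (inner_self_ne_zero.2 hb'0)] at m
    have := P.neg_mem (hJP _ m)
    rwa [JJ, neg_neg] at this
  have hL : Function.Injective (A.codRestrict P hAP) := by
    rw [← LinearMap.ker_eq_bot, LinearMap.ker_eq_bot']
    intro x hx
    exact hinj x (congrArg Subtype.val hx)
  exact (LinearMap.finrank_le_finrank_of_injective hL).trans (finrank_span_range_le _)

include JJ inner_J h nondeg in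
/-- If the complex bivectors `A x ∧ A y` are all proportional to a fixed one, with factor the
skew part of `A`, and this skew part is nondegenerate, then the dimension is at most four. -/
theorem finrank_le_four [FiniteDimensional ℝ W] : finrank ℝ W ≤ 4 := by
  by_cases hS : ∀ z, S z = 0
  · exact finrank_le_four_of_eq_zero J A S JJ inner_J h nondeg hS
  · push Not at hS
    obtain ⟨z₀, hz₀⟩ := hS
    exact finrank_le_four_of_ne_zero J A S JJ inner_J h nondeg z₀ hz₀

end ComplexStructure

section Contact

variable {V : Type*} [AddCommGroup V] [Module ℝ V]

/-- The multilinear form `η ⊗ Ω ⊗ ⋯ ⊗ Ω` with `n` factors `Ω`. -/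
noncomputable def tensorPow (η : V →ₗ[ℝ] ℝ) (Ω : V →ₗ[ℝ] V →ₗ[ℝ] ℝ) (n : ℕ) :
    MultilinearMap ℝ (fun _ : Fin (2 * n + 1) ↦ V) ℝ :=
  have key : ∀ (x : Fin (2 * n + 1) → V) (k : Fin (2 * n + 1)), ∃ f : V →ₗ[ℝ] ℝ, ∀ v,
      η (Function.update x k v 0) * ∏ i : Fin n, Ω (Function.update x k v ⟨2 * i + 1, by omega⟩)
        (Function.update x k v ⟨2 * i + 2, by omega⟩) = f v := by
    intro x k
    by_cases hk : k = 0
    · subst hk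
      refine ⟨(∏ i : Fin n, Ω (x ⟨2 * i + 1, by omega⟩) (x ⟨2 * i + 2, by omega⟩)) • η, fun v ↦ ?_⟩
      simp [Function.update_of_ne, mul_comm]
    · have hk0 : (k : ℕ) ≠ 0 := fun h ↦ hk (Fin.ext h)
      obtain ⟨j, hj⟩ : ∃ j : Fin n, (k : ℕ) = 2 * j + 1 ∨ (k : ℕ) = 2 * j + 2 :=
        ⟨⟨((k : ℕ) - 1) / 2, by omega⟩, by simp only; omega⟩
      have hprod : ∀ v, ∏ i ∈ Finset.univ.erase j,
          Ω (Function.update x k v ⟨2 * i + 1, by omega⟩)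
            (Function.update x k v ⟨2 * i + 2, by omega⟩)
          = ∏ i ∈ Finset.univ.erase j, Ω (x ⟨2 * i + 1, by omega⟩) (x ⟨2 * i + 2, by omega⟩) := by
        intro v
        refine Finset.prod_congr rfl fun i hi ↦ ?_
        have hij : (i : ℕ) ≠ j := fun h ↦ Finset.ne_of_mem_erase hi (Fin.ext h)
        rw [Function.update_of_ne, Function.update_of_ne]
        · intro h; have := congrArg Fin.val h; simp only at this; omega
        · intro h; have := congrArg Fin.val h; simp only at this; omega
      obtain ⟨g, hg⟩ : ∃ g : V →ₗ[ℝ] ℝ, ∀ v, Ω (Function.update x k v ⟨2 * j + 1, by omega⟩)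
            (Function.update x k v ⟨2 * j + 2, by omega⟩) = g v := by
        rcases hj with hj | hj
        · refine ⟨Ω.flip (x ⟨2 * j + 2, by omega⟩), fun v ↦ ?_⟩
          have e : k = ⟨2 * j + 1, by omega⟩ := Fin.ext hj
          simp only [← e]
          rw [Function.update_self, Function.update_of_ne]
          · rfl
          · intro h; have := congrArg Fin.val h; simp only at this; omega
        · refine ⟨Ω (x ⟨2 * j + 1, by omega⟩), fun v ↦ ?_⟩
          have e : k = ⟨2 * j + 2, by omega⟩ := Fin.ext hj
          simp only [← e]
          rw [Function.update_self, Function.update_of_ne]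
          intro h; have := congrArg Fin.val h; simp only at this; omega
      refine ⟨(η (x 0) * ∏ i ∈ Finset.univ.erase j,
        Ω (x ⟨2 * i + 1, by omega⟩) (x ⟨2 * i + 2, by omega⟩)) • g, fun v ↦ ?_⟩
      rw [← Finset.mul_prod_erase _ _ (Finset.mem_univ j), hprod, hg,
        Function.update_of_ne (Ne.symm hk), LinearMap.smul_apply, smul_eq_mul]
      ring
  MultilinearMap.mk' (fun x ↦ η (x 0) * ∏ i : Fin n, Ω (x ⟨2 * i + 1, by omega⟩)
      (x ⟨2 * i + 2, by omega⟩))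
    (fun x k u v ↦ by
      obtain ⟨f, hf⟩ := key x k
      simp only [hf, map_add])
    (fun x k c v ↦ by
      obtain ⟨f, hf⟩ := key x k
      simp only [hf, map_smul])

/-- A vector of `ker η` which is `Ω`-orthogonal to `ker η` vanishes, when `η ∧ Ω ^ n ≠ 0`. -/
theorem eq_zero_of_wedge_ne_zero (n : ℕ) [FiniteDimensional ℝ W] (hW : finrank ℝ W = 2 * n + 1)
    (ξ : W) (hξ : inner ℝ ξ ξ = 1) (Ω : W →ₗ[ℝ] W →ₗ[ℝ] ℝ) (x : Fin (2 * n + 1) → W)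
    (hx : ∑ σ : Equiv.Perm (Fin (2 * n + 1)), ((Equiv.Perm.sign σ : ℤ) : ℝ) *
      (inner ℝ ξ (x (σ 0)) * ∏ i : Fin n, Ω (x (σ ⟨2 * i + 1, by omega⟩))
        (x (σ ⟨2 * i + 2, by omega⟩))) ≠ 0)
    (v : W) (hv : inner ℝ ξ v = 0) (hΩ : ∀ w, inner ℝ ξ w = 0 → Ω v w = 0)
    (hΩ' : ∀ w, inner ℝ ξ w = 0 → Ω w v = 0) (hn : 1 ≤ n) : v = 0 := by
  by_contra hv0
  let Θ := MultilinearMap.alternatization (tensorPow (innerₗ W ξ) Ω n)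
  have hΘ : ∀ y, Θ y = ∑ σ : Equiv.Perm (Fin (2 * n + 1)), ((Equiv.Perm.sign σ : ℤ) : ℝ) *
      (inner ℝ ξ (y (σ 0)) * ∏ i : Fin n, Ω (y (σ ⟨2 * i + 1, by omega⟩))
        (y (σ ⟨2 * i + 2, by omega⟩))) := by
    intro y
    simp only [Θ, MultilinearMap.alternatization_apply]
    refine Finset.sum_congr rfl fun σ _ ↦ ?_
    rw [Units.smul_def, zsmul_eq_mul]
    rfl
  let i1 : Fin (2 * n + 1) := ⟨1, by omega⟩
  have hi1 : i1 ≠ 0 := fun h ↦ by simpa [i1] using congrArg Fin.val h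
  let u : Fin (2 * n + 1) → W := fun i ↦ if i = 0 then ξ else ‖v‖⁻¹ • v
  have hu : Orthonormal ℝ (({0, i1} : Set (Fin (2 * n + 1))).domRestrict u) := by
    have hvn : ‖v‖ ≠ 0 := norm_ne_zero_iff.2 hv0
    constructor
    · rintro ⟨i, hi⟩
      rcases hi with rfl | rfl
      · have : ‖ξ‖ ^ 2 = 1 := by rw [← real_inner_self_eq_norm_sq, hξ]
        simpa [u] using (pow_eq_one_iff_of_nonneg (norm_nonneg ξ) two_ne_zero).1 this
      · simp [Set.domRestrict_apply, u, hi1, norm_smul, hvn]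
    · rintro ⟨i, hi⟩ ⟨j, hj⟩ hij
      have hij : i ≠ j := fun h ↦ hij (Subtype.ext h)
      rcases hi with rfl | rfl <;> rcases hj with rfl | rfl
      · exact absurd rfl hij
      · simp [Set.domRestrict_apply, u, hi1, inner_smul_right, hv]
      · simp [Set.domRestrict_apply, u, hi1, inner_smul_left, real_inner_comm, hv]
      · exact absurd rfl hij
  obtain ⟨b, hb⟩ := hu.exists_orthonormalBasis_extension_of_card_eq (by simpa using hW)
  have hb0 : b 0 = ξ := by simpa [u] using hb 0 (by simp)
  have hb1 : b i1 = ‖v‖⁻¹ • v := by simpa [u, hi1] using hb i1 (by simp)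
  have hbi : ∀ i, i ≠ 0 → inner ℝ ξ (b i) = 0 := fun i hi ↦ by
    rw [← hb0]; exact b.orthonormal.2 hi.symm
  have hΘb : Θ b = 0 := by
    rw [hΘ]
    refine Finset.sum_eq_zero fun σ _ ↦ ?_
    by_cases h0 : σ 0 = 0
    · have hs0 : ∀ j, j ≠ 0 → σ j ≠ 0 := fun j hj h ↦ hj (σ.injective (h.trans h0.symm))
      obtain ⟨k, hk⟩ := σ.surjective i1
      have hk0 : (k : ℕ) ≠ 0 := fun h ↦ by
        have : k = 0 := Fin.ext h
        rw [this, h0] at hk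
        exact hi1 hk.symm
      obtain ⟨j, hj⟩ : ∃ j : Fin n, (k : ℕ) = 2 * j + 1 ∨ (k : ℕ) = 2 * j + 2 :=
        ⟨⟨((k : ℕ) - 1) / 2, by omega⟩, by simp only; omega⟩
      have e1 : (⟨2 * j + 1, by omega⟩ : Fin (2 * n + 1)) ≠ 0 := fun h ↦ by
        simpa using congrArg Fin.val h
      have e2 : (⟨2 * j + 2, by omega⟩ : Fin (2 * n + 1)) ≠ 0 := fun h ↦ by
        simpa using congrArg Fin.val h
      rw [Finset.prod_eq_zero (Finset.mem_univ j), mul_zero, mul_zero]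
      rcases hj with hj | hj
      · have e : k = ⟨2 * j + 1, by omega⟩ := Fin.ext hj
        rw [← e, hk, hb1, map_smul, LinearMap.smul_apply, hΩ _ (hbi _ (hs0 _ e2)), smul_zero]
      · have e : k = ⟨2 * j + 2, by omega⟩ := Fin.ext hj
        rw [← e, hk, hb1, map_smul, hΩ' _ (hbi _ (hs0 _ e1)), smul_zero]
    · rw [hbi _ h0, zero_mul, mul_zero]
  have hΘ0 : Θ = 0 := (Θ.map_basis_eq_zero_iff b.toBasis).1 (by simpa using hΘb)
  rw [← hΘ, hΘ0] at hx
  exact hx rfl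

end Contact

end LinearAlgebra

section Horizontal

open Module

section Anti

variable {W : Type*} [NormedAddCommGroup W] [InnerProductSpace ℝ W] [FiniteDimensional ℝ W]
  (J A : W →ₗ[ℝ] W) (JJ : ∀ x, J (J x) = -x) (inner_J : ∀ x y, inner ℝ (J x) (J y) = inner ℝ x y)
  (nondeg : ∀ x, (∀ y, inner ℝ (A x) y - inner ℝ x (A y) = 0) → x = 0)
  (anti : ∀ x y, inner ℝ (A (J x)) (J y) - inner ℝ (J x) (A (J y))
    = -(inner ℝ (A x) y - inner ℝ x (A y)))

include JJ inner_J nondeg anti in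
/-- In real dimension two there is no nondegenerate skew form which changes sign under the complex
structure. -/
theorem finrank_ne_two_of_anti : finrank ℝ W ≠ 2 := by
  intro h2
  have : Nontrivial W := Module.nontrivial_of_finrank_pos (R := ℝ) (by omega)
  obtain ⟨x, hx⟩ := exists_ne (0 : W)
  have hxJ : (inner ℝ (J x) x : ℝ) = 0 := inner_complexStructure_self J JJ inner_J x
  have hli : LinearIndependent ℝ ![x, J x] := by
    rw [LinearIndependent.pair_iff' hx]
    intro t ht
    have h := inner_J x x
    rw [← ht, inner_smul_left, inner_smul_right] at h
    rw [← ht, inner_smul_left] at hxJ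
    rcases mul_eq_zero.1 hxJ with h0 | h0
    · rw [h0, zero_mul] at h
      exact hx (inner_self_eq_zero.1 h.symm)
    · exact hx (inner_self_eq_zero.1 h0)
  have htop := hli.span_eq_top_of_card_eq_finrank' (by rw [h2]; rfl)
  refine hx (nondeg x fun y ↦ ?_)
  have hy : y ∈ Submodule.span ℝ (Set.range ![x, J x]) := by rw [htop]; trivial
  induction hy using Submodule.span_induction with
  | mem y hy =>
    obtain ⟨i, rfl⟩ := hy
    fin_cases i
    · exact sub_eq_zero.2 (real_inner_comm _ _)
    · have h := anti x (J x)
      rw [JJ, map_neg, inner_neg_right, inner_neg_right, real_inner_comm (A x) (J x),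
        real_inner_comm x] at h
      change inner ℝ (A x) (J x) - inner ℝ x (A (J x)) = 0
      linarith
  | zero => simp
  | add a b _ _ ha hb =>
    rw [map_add, inner_add_right, inner_add_right]
    linarith
  | smul c a _ ha =>
    rw [map_smul, inner_smul_right, inner_smul_right, ← mul_sub, ha, mul_zero]

end Anti

/-- The linear algebra behind the main theorem: `α` is the covariant derivative of the unit normal
`ξ`, and `gauss` is the horizontal part of the commutator of the curvature with `φ`. -/
theorem eq_two_of_gauss {V : Type*} [NormedAddCommGroup V] [InnerProductSpace ℝ V]
    [FiniteDimensional ℝ V] (n : ℕ) (hn : 1 ≤ n) (hdim : finrank ℝ V = 2 * n + 1) (ξ : V)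
    (hξ : ξ ≠ 0) (φ α : V →ₗ[ℝ] V) (S : V → V)
    (phi_phi : ∀ v, inner ℝ ξ v = 0 → φ (φ v) = -v) (inner_xi_phi : ∀ v, inner ℝ ξ (φ v) = 0)
    (inner_phi_phi : ∀ u v, inner ℝ ξ u = 0 → inner ℝ (φ u) (φ v) = inner ℝ u v)
    (inner_phi_left : ∀ u v, inner ℝ (φ u) v = -inner ℝ u (φ v))
    (inner_xi_alpha : ∀ v, inner ℝ ξ v = 0 → inner ℝ ξ (α v) = 0)
    (nondeg : ∀ v, inner ℝ ξ v = 0 →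
      (∀ w, inner ℝ ξ w = 0 → inner ℝ (α v) w - inner ℝ (α w) v = 0) → v = 0)
    (anti : ∀ u v, inner ℝ ξ u = 0 → inner ℝ ξ v = 0 →
      inner ℝ (α (φ u)) (φ v) - inner ℝ (α (φ v)) (φ u) = -(inner ℝ (α u) v - inner ℝ (α v) u))
    (gauss : ∀ x y z w, inner ℝ ξ x = 0 → inner ℝ ξ y = 0 → inner ℝ ξ z = 0 → inner ℝ ξ w = 0 →
      inner ℝ z (α y) * inner ℝ (φ (α x)) w - inner ℝ (φ z) (α y) * inner ℝ (α x) w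
        - inner ℝ z (α x) * inner ℝ (φ (α y)) w + inner ℝ (φ z) (α x) * inner ℝ (α y) w
        - (inner ℝ x (α y) - inner ℝ y (α x)) * inner ℝ (S z) w = 0) : n = 2 := by
  let D : Submodule ℝ V := (Submodule.span ℝ {ξ})ᗮ
  have hD : ∀ u : D, inner ℝ ξ (u : V) = 0 := fun u ↦
    Submodule.mem_orthogonal_singleton_iff_inner_right.1 u.2
  have mem : ∀ u, inner ℝ ξ u = 0 → u ∈ D := fun u ↦
    Submodule.mem_orthogonal_singleton_iff_inner_right.2
  have hDdim : finrank ℝ D = 2 * n := by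
    have : Fact (finrank ℝ V = 2 * n + 1) := ⟨hdim⟩
    exact Submodule.finrank_orthogonal_span_singleton hξ
  let J : D →ₗ[ℝ] D := φ.restrict fun u _ ↦ mem _ (inner_xi_phi u)
  let A : D →ₗ[ℝ] D := (-α).restrict fun u hu ↦ mem _ (by
    simp [inner_xi_alpha u (hD ⟨u, hu⟩)])
  let S' : D → D := fun z ↦ D.orthogonalProjectionOnto (S z)
  have hJ : ∀ u : D, (J u : V) = φ u := fun u ↦ rfl
  have hA : ∀ u : D, (A u : V) = -α u := fun u ↦ rfl
  have hi : ∀ u v : D, inner ℝ u v = inner ℝ (u : V) (v : V) := fun u v ↦ rfl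
  have hS : ∀ z w : D, inner ℝ (S' z) w = inner ℝ (S z) (w : V) := fun z w ↦
    Submodule.inner_orthogonalProjectionOnto_eq_of_mem_right w (S z)
  have JJ : ∀ u, J (J u) = -u := fun u ↦ Subtype.ext (phi_phi u (hD u))
  have hJi : ∀ u v, inner ℝ (J u) (J v) = inner ℝ u v := fun u v ↦ inner_phi_phi _ _ (hD u)
  have hω : ∀ x y : D, inner ℝ (A x) y - inner ℝ x (A y)
      = -(inner ℝ (α x) (y : V) - inner ℝ (α y) (x : V)) := fun x y ↦ by
    rw [hi, hi, hA, hA, inner_neg_left, inner_neg_right, real_inner_comm (α y)]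
    ring
  have nondeg' : ∀ x : D, (∀ y : D, inner ℝ (A x) y - inner ℝ x (A y) = 0) → x = 0 := by
    intro x hx
    refine Subtype.ext (nondeg x (hD x) fun w hw ↦ ?_)
    have := hx ⟨w, mem w hw⟩
    rw [hω] at this
    exact neg_eq_zero.1 this
  have gauss' : ∀ x y z : D, inner ℝ (J (A y)) z • A x - inner ℝ (J (A x)) z • A y
      + inner ℝ (A y) z • J (A x) - inner ℝ (A x) z • J (A y)
        = (inner ℝ (A x) y - inner ℝ x (A y)) • S' z := by
    intro x y z
    refine ext_inner_right ℝ fun w ↦ ?_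
    have h := gauss x y z w (hD x) (hD y) (hD z) (hD w)
    simp only [inner_sub_left, inner_add_left, inner_smul_left, hS, hω, conj_trivial]
    simp only [hi, hJ, hA, map_neg, inner_neg_left]
    rw [inner_phi_left (α x) z, inner_phi_left (α y) z, real_inner_comm (φ z),
      real_inner_comm (φ z), real_inner_comm (z : V), real_inner_comm (z : V),
      real_inner_comm (x : V) (α y)]
    rw [real_inner_comm (α x) (y : V)] at h
    linarith
  have h4 := finrank_le_four J A S' JJ hJi gauss' nondeg'
  have h2 := finrank_ne_two_of_anti J A JJ hJi nondeg' fun x y ↦ by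
    rw [hω, hω, hJ, hJ, anti x y (hD x) (hD y)]
  omega

end Horizontal

namespace ContactMetric

section SmoothFields

variable {E : Type*} [NormedAddCommGroup E] [NormedSpace ℝ E]
  {H : Type*} [TopologicalSpace H] {I : ModelWithCorners ℝ E H}
  {M : Type*} [TopologicalSpace M] [ChartedSpace H M] [IsManifold I ∞ M]
  {X Y Z : Π x : M, TangentSpace I x}

theorem IsSmoothField.mdifferentiableAt (hX : IsSmoothField I X) (x : M) :
    MDifferentiableAt I I.tangent
      (fun y ↦ (TotalSpace.mk' E y (X y) : TangentBundle I M)) x :=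
  (ContMDiff.contMDiffAt hX).mdifferentiableAt (by simp)

theorem IsSmoothField.sub (hX : IsSmoothField I X) (hY : IsSmoothField I Y) :
    IsSmoothField I (X - Y) :=
  ContMDiff.sub_section hX hY

theorem IsSmoothField.smul {f : M → ℝ} (hf : ContMDiff I 𝓘(ℝ, ℝ) ∞ f) (hX : IsSmoothField I X) :
    IsSmoothField I (f • X) :=
  ContMDiff.smul_section hf hX

theorem IsSmoothField.apply_oneForm {η : Π x : M, TangentSpace I x →L[ℝ] ℝ}
    (hη : IsSmoothOneForm I η) (hX : IsSmoothField I X) :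
    ContMDiff I 𝓘(ℝ, ℝ) ∞ (fun x ↦ η x (X x)) := by
  have : ContMDiff I (I.prod 𝓘(ℝ, ℝ)) ∞
      (fun m ↦ TotalSpace.mk' ℝ (E := Bundle.Trivial M ℝ) m (η m (X m))) :=
    ContMDiff.clm_bundle_apply (F₁ := E) (E₁ := fun x : M ↦ TangentSpace I x) (F₂ := ℝ)
      (E₂ := Bundle.Trivial M ℝ) hη hX
  intro x
  have := this x
  simp only [contMDiffAt_totalSpace] at this
  exact this.2

theorem IsSmoothField.apply_endomorphism {φ : Π x : M, TangentSpace I x →L[ℝ] TangentSpace I x}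
    (hφ : IsSmoothEndomorphism I φ) (hX : IsSmoothField I X) :
    IsSmoothField I (fun x ↦ φ x (X x)) :=
  ContMDiff.clm_bundle_apply (F₁ := E) (E₁ := fun x : M ↦ TangentSpace I x) (F₂ := E)
    (E₂ := fun x : M ↦ TangentSpace I x) hφ hX

theorem IsSmoothField.mlieBracket [CompleteSpace E] (hX : IsSmoothField I X)
    (hY : IsSmoothField I Y) : IsSmoothField I (VectorField.mlieBracket I X Y) := by
  have : IsManifold I (minSmoothness ℝ 2) M := by
    rw [minSmoothness_of_isRCLikeNormedField]; infer_instance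
  have : IsManifold I (((⊤ : ℕ∞) : WithTop ℕ∞) + 1) M := by simpa using ‹IsManifold I ∞ M›
  exact ContDiff.mlieBracket_vectorField (m := ⊤) (n := ⊤) hX hY (by simp)

/-- The Jacobi identity for smooth vector fields. -/
theorem leibniz_mlieBracket_apply [CompleteSpace E] (hX : IsSmoothField I X)
    (hY : IsSmoothField I Y) (hZ : IsSmoothField I Z) (x : M) :
    VectorField.mlieBracket I X (VectorField.mlieBracket I Y Z) x
      = VectorField.mlieBracket I (VectorField.mlieBracket I X Y) Z x
        + VectorField.mlieBracket I Y (VectorField.mlieBracket I X Z) x := by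
  have : IsManifold I (minSmoothness ℝ 3) M := by
    rw [minSmoothness_of_isRCLikeNormedField]
    exact IsManifold.of_le (n := ∞) (WithTop.coe_le_coe.2 (le_top (a := (3 : ℕ∞))))
  have hC : ∀ {W : Π x : M, TangentSpace I x}, IsSmoothField I W →
      ContMDiffAt I I.tangent (minSmoothness ℝ 2)
        (fun y ↦ (TotalSpace.mk' E y (W y) : TangentBundle I M)) x := fun hW ↦ by
    rw [minSmoothness_of_isRCLikeNormedField]
    exact (ContMDiff.contMDiffAt hW).of_le
      (WithTop.coe_le_coe.2 (le_top (a := (2 : ℕ∞))))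
  exact VectorField.leibniz_identity_mlieBracket_apply (hC hX) (hC hY) (hC hZ)

theorem contMDiff_mvfderiv_apply {f : M → ℝ} (hf : ContMDiff I 𝓘(ℝ, ℝ) ∞ f)
    (hX : IsSmoothField I X) : ContMDiff I 𝓘(ℝ, ℝ) ∞ (fun x ↦ mvfderiv I f x (X x)) := by
  have h1 := (hf.contMDiff_tangentMap (m := ∞) (by simp)).comp hX
  exact (contMDiff_snd_tangentBundle_modelSpace ℝ 𝓘(ℝ, ℝ)).comp h1

end SmoothFields

section Extension

variable {E : Type*} [NormedAddCommGroup E] [NormedSpace ℝ E] [FiniteDimensional ℝ E]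
  {H : Type*} [TopologicalSpace H] {I : ModelWithCorners ℝ E H}
  {M : Type*} [TopologicalSpace M] [T2Space M] [ChartedSpace H M] [IsManifold I ∞ M]

/-- Tangent vectors at a point extend linearly to smooth vector fields. -/
theorem exists_linear_extension (p : M) :
    ∃ e : TangentSpace I p →ₗ[ℝ] (Π x : M, TangentSpace I x),
      (∀ v, IsSmoothField I (e v)) ∧ ∀ v, e v p = v := by
  let ψ : SmoothBumpFunction I p := Classical.arbitrary _
  let t := trivializationAt E (TangentSpace I : M → Type _) p
  have hp : p ∈ t.baseSet := FiberBundle.mem_baseSet_trivializationAt' p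
  refine ⟨{ toFun := fun v ↦ (ψ : M → ℝ) • fun x ↦ t.symmL ℝ x (t.continuousLinearMapAt ℝ p v)
            map_add' := fun u v ↦ ?_
            map_smul' := fun c v ↦ ?_ }, fun v ↦ ?_, fun v ↦ ?_⟩
  · ext x
    simp only [map_add, Pi.smul_apply', Pi.add_apply, smul_add]
  · ext x
    simp only [map_smul, Pi.smul_apply', Pi.smul_apply, RingHom.id_apply]
    rw [smul_comm]
  · refine ContMDiffOn.smul_section_of_tsupport (u := t.baseSet) ψ.contMDiff.contMDiffOn
      t.open_baseSet ?_ ?_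
    · simpa [t] using ψ.tsupport_subset_chartAt_source
    · intro x hx
      rw [t.contMDiffWithinAt_section _ hx]
      have key : ∀ y ∈ t.baseSet, (t ⟨y, t.symmL ℝ y (t.continuousLinearMapAt ℝ p v)⟩).2
          = t.continuousLinearMapAt ℝ p v := fun y hy ↦ by
        rw [← t.continuousLinearMapAt_apply_of_mem (R := ℝ) hy, t.continuousLinearMapAt_symmL hy]
      exact (contMDiffWithinAt_const (c := t.continuousLinearMapAt ℝ p v)).congr key (key x hx)
  · change ψ p • t.symmL ℝ p (t.continuousLinearMapAt ℝ p v) = v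
    rw [ψ.eq_one, one_smul, t.symmL_continuousLinearMapAt hp]

end Extension

section Derivation

variable {E : Type*} [NormedAddCommGroup E] [NormedSpace ℝ E] [FiniteDimensional ℝ E]
  {H : Type*} [TopologicalSpace H] {I : ModelWithCorners ℝ E H}
  {M : Type*} [TopologicalSpace M] [T2Space M] [ChartedSpace H M] [IsManifold I ∞ M]
  {X Y Z : Π x : M, TangentSpace I x} {f : M → ℝ}

theorem mvfderiv_mlieBracket_apply (hf : ContMDiff I 𝓘(ℝ, ℝ) ∞ f) (hX : IsSmoothField I X)
    (hY : IsSmoothField I Y) (x : M) :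
    mvfderiv I f x (VectorField.mlieBracket I X Y x)
      = mvfderiv I (fun y ↦ mvfderiv I f y (Y y)) x (X x)
        - mvfderiv I (fun y ↦ mvfderiv I f y (X y)) x (Y x) := by
  rcases subsingleton_or_nontrivial (TangentSpace I x) with hs | hs
  · rw [Subsingleton.elim (X x) 0, Subsingleton.elim (Y x) 0,
      Subsingleton.elim (VectorField.mlieBracket I X Y x) 0]
    simp
  obtain ⟨v, hv⟩ := exists_ne (0 : TangentSpace I x)
  obtain ⟨e, he, hev⟩ := exists_linear_extension (I := I) x
  obtain ⟨Z, hZ, hZx⟩ : ∃ Z, IsSmoothField I Z ∧ Z x = v := ⟨e v, he v, hev v⟩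
  have hd : ∀ {g : M → ℝ}, ContMDiff I 𝓘(ℝ, ℝ) ∞ g → ∀ y, MDifferentiableAt I 𝓘(ℝ, ℝ) g y :=
    fun hg y ↦ hg.contMDiffAt.mdifferentiableAt (by simp)
  have hb : ∀ {W : Π x : M, TangentSpace I x}, VectorField.mlieBracket I W (f • Z)
      = (fun y ↦ mvfderiv I f y (W y)) • Z + f • VectorField.mlieBracket I W Z := fun {W} ↦ by
    ext y
    exact VectorField.mlieBracket_smul_right (hd hf y) (hZ.mdifferentiableAt y)
  have hXf := contMDiff_mvfderiv_apply hf hX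
  have hYf := contMDiff_mvfderiv_apply hf hY
  have hXZ := hX.mlieBracket hZ
  have hYZ := hY.mlieBracket hZ
  have j := leibniz_mlieBracket_apply hX hY (hZ.smul hf) x
  have j' := leibniz_mlieBracket_apply hX hY hZ x
  simp only [hb] at j
  rw [VectorField.mlieBracket_add_right ((hZ.smul hYf).mdifferentiableAt x)
      ((hYZ.smul hf).mdifferentiableAt x),
    VectorField.mlieBracket_add_right ((hZ.smul hXf).mdifferentiableAt x)
      ((hXZ.smul hf).mdifferentiableAt x),
    VectorField.mlieBracket_smul_right (hd hYf x) (hZ.mdifferentiableAt x),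
    VectorField.mlieBracket_smul_right (hd hXf x) (hZ.mdifferentiableAt x),
    VectorField.mlieBracket_smul_right (hd hf x) (hYZ.mdifferentiableAt x),
    VectorField.mlieBracket_smul_right (hd hf x) (hXZ.mdifferentiableAt x), j'] at j
  simp only [Pi.add_apply, Pi.smul_apply', hZx] at j
  refine smul_left_injective ℝ hv ?_
  simp only
  rw [sub_smul, eq_sub_iff_add_eq, ← sub_eq_zero]
  rw [← sub_eq_zero] at j
  rw [← neg_eq_zero, ← j]
  module

end Derivation

end ContactMetric

namespace ContactMetric

section Connection

variable {E : Type*} [NormedAddCommGroup E] [NormedSpace ℝ E]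
  {H : Type*} [TopologicalSpace H] {I : ModelWithCorners ℝ E H}
  {M : Type*} [TopologicalSpace M] [ChartedSpace H M]

theorem contMDiffAt_matrix_det {ι : Type*} [Fintype ι] [DecidableEq ι] {G : M → Matrix ι ι ℝ}
    {p : M} (hG : ∀ i j, ContMDiffAt I 𝓘(ℝ, ℝ) ∞ (fun x ↦ G x i j) p) :
    ContMDiffAt I 𝓘(ℝ, ℝ) ∞ (fun x ↦ (G x).det) p := by
  simp only [Matrix.det_apply, Units.smul_def, zsmul_eq_mul]
  exact ContMDiffAt.sum fun σ _ ↦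
    contMDiffAt_const.mul (contMDiffAt_finsetProd fun i _ ↦ hG _ _)

variable [IsManifold I ∞ M]
  {nabla : CovariantDerivative I E (fun x : M ↦ TangentSpace I x)}
  {Y Z : Π x : M, TangentSpace I x}

theorem covD_add_right (X : Π x : M, TangentSpace I x) (hY : IsSmoothField I Y)
    (hZ : IsSmoothField I Z) : covD nabla X (Y + Z) = covD nabla X Y + covD nabla X Z := by
  ext x
  simp only [covD, Pi.add_apply]
  rw [nabla.isCovariantDerivativeOnUniv.add (hY.mdifferentiableAt x) (hZ.mdifferentiableAt x)]
  rfl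

theorem covD_smul_right (X : Π x : M, TangentSpace I x) {f : M → ℝ}
    (hf : ContMDiff I 𝓘(ℝ, ℝ) ∞ f) (hY : IsSmoothField I Y) (x : M) :
    covD nabla X (f • Y) x = f x • covD nabla X Y x + mvfderiv I f x (X x) • Y x := by
  simp only [covD]
  rw [nabla.isCovariantDerivativeOnUniv.leibniz (hY.mdifferentiableAt x)
    (hf.contMDiffAt.mdifferentiableAt (by simp))]
  rfl

theorem covD_sub_right (X : Π x : M, TangentSpace I x) (hY : IsSmoothField I Y)
    (hZ : IsSmoothField I Z) : covD nabla X (Y - Z) = covD nabla X Y - covD nabla X Z := by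
  rw [eq_sub_iff_add_eq, ← covD_add_right X (hY.sub hZ) hZ, sub_add_cancel]

theorem covD_add_left (X Y Z : Π x : M, TangentSpace I x) :
    covD nabla (X + Y) Z = covD nabla X Z + covD nabla Y Z := by
  ext x
  exact map_add (nabla Z x) _ _

theorem curvature_swap (X Y Z : Π x : M, TangentSpace I x) (x : M) :
    curvature nabla X Y Z x = -curvature nabla Y X Z x := by
  simp only [curvature, covD]
  rw [VectorField.mlieBracket_swap_apply, map_neg]
  abel

end Connection

section Riemannian

variable {E : Type*} [NormedAddCommGroup E] [NormedSpace ℝ E]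
  {H : Type*} [TopologicalSpace H] {I : ModelWithCorners ℝ E H}
  {M : Type*} [TopologicalSpace M] [ChartedSpace H M] [IsManifold I ∞ M]
  [RiemannianBundle (fun x : M ↦ TangentSpace I x)]
  {X Y Z W : Π x : M, TangentSpace I x}

section

variable [IsContMDiffRiemannianBundle I ∞ E (fun x : M ↦ TangentSpace I x)]

theorem IsSmoothField.inner (hX : IsSmoothField I X) (hY : IsSmoothField I Y) :
    ContMDiff I 𝓘(ℝ, ℝ) ∞ (fun x ↦ (inner ℝ (X x) (Y x) : ℝ)) :=
  ContMDiff.inner_bundle (F := E) (E := fun x : M ↦ TangentSpace I x) hX hY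

end

variable [FiniteDimensional ℝ E]

section

variable {nabla : CovariantDerivative I E (fun x : M ↦ TangentSpace I x)}

theorem IsLeviCivita.covD_sub_covD (hn : IsLeviCivita nabla) (hX : IsSmoothField I X)
    (hY : IsSmoothField I Y) :
    covD nabla X Y - covD nabla Y X = VectorField.mlieBracket I X Y := by
  ext x
  exact nabla.torsion_eq_zero_iff.1 hn.torsion_eq_zero (hX.mdifferentiableAt x)
    (hY.mdifferentiableAt x)

theorem IsLeviCivita.mvfderiv_inner (hn : IsLeviCivita nabla) (X : Π x : M, TangentSpace I x)
    (hY : IsSmoothField I Y) (hZ : IsSmoothField I Z) (x : M) :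
    mvfderiv I (fun y ↦ (inner ℝ (Y y) (Z y) : ℝ)) x (X x)
      = inner ℝ (covD nabla X Y x) (Z x) + inner ℝ (Y x) (covD nabla X Z x) :=
  hn.metric X Y Z x (hY.mdifferentiableAt x) (hZ.mdifferentiableAt x)

theorem IsLeviCivita.koszul (hn : IsLeviCivita nabla) (hX : IsSmoothField I X)
    (hY : IsSmoothField I Y) (hZ : IsSmoothField I Z) (x : M) :
    inner ℝ (covD nabla X Y x) (Z x) = (1 / 2 : ℝ) *
      (mvfderiv I (fun y ↦ (inner ℝ (Y y) (Z y) : ℝ)) x (X x)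
      + mvfderiv I (fun y ↦ (inner ℝ (Z y) (X y) : ℝ)) x (Y x)
      - mvfderiv I (fun y ↦ (inner ℝ (X y) (Y y) : ℝ)) x (Z x)
      + inner ℝ (VectorField.mlieBracket I X Y x) (Z x)
      - inner ℝ (Y x) (VectorField.mlieBracket I X Z x)
      - inner ℝ (X x) (VectorField.mlieBracket I Y Z x)) := by
  rw [hn.mvfderiv_inner X hY hZ, hn.mvfderiv_inner Y hZ hX, hn.mvfderiv_inner Z hX hY,
    ← hn.covD_sub_covD hX hY, ← hn.covD_sub_covD hX hZ, ← hn.covD_sub_covD hY hZ]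
  simp only [Pi.sub_apply, inner_sub_left, inner_sub_right]
  rw [real_inner_comm (covD nabla Y Z x) (X x), real_inner_comm (covD nabla Y X x) (Z x),
    real_inner_comm (covD nabla Z X x) (Y x)]
  ring

end

variable [IsContMDiffRiemannianBundle I ∞ E (fun x : M ↦ TangentSpace I x)]
  {nabla : CovariantDerivative I E (fun x : M ↦ TangentSpace I x)}

theorem isSmoothField_of_inner [T2Space M]
    (h : ∀ W, IsSmoothField I W → ContMDiff I 𝓘(ℝ, ℝ) ∞ (fun x ↦ (inner ℝ (X x) (W x) : ℝ))) :
    IsSmoothField I X := by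
  intro p
  have hfd : ∀ x : M, FiniteDimensional ℝ (TangentSpace I x) := fun x ↦
    inferInstanceAs (FiniteDimensional ℝ E)
  obtain ⟨e, he, hep⟩ := exists_linear_extension (I := I) p
  let b := stdOrthonormalBasis ℝ (TangentSpace I p)
  let s := fun i ↦ e (b i)
  have hs : ∀ i, IsSmoothField I (s i) := fun i ↦ he _
  let G := fun x : M ↦ Matrix.of fun i j ↦ (inner ℝ (s i x) (s j x) : ℝ)
  let v := fun (x : M) i ↦ (inner ℝ (X x) (s i x) : ℝ)
  have hG : ∀ i j, ContMDiffAt I 𝓘(ℝ, ℝ) ∞ (fun x ↦ G x i j) p := fun i j ↦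
    ((hs i).inner (hs j)).contMDiffAt
  have hv : ∀ i, ContMDiffAt I 𝓘(ℝ, ℝ) ∞ (fun x ↦ v x i) p := fun i ↦ (h _ (hs i)).contMDiffAt
  have hdet := contMDiffAt_matrix_det hG
  have hdet0 : (G p).det ≠ 0 := by
    have : G p = 1 := by
      ext i j
      simp only [G, s, hep, Matrix.of_apply, Matrix.one_apply]
      exact orthonormal_iff_ite.1 b.orthonormal i j
    simp [this]
  let c := fun (x : M) i ↦ ((G x).det)⁻¹ * (G x).cramer (v x) i
  have hc : ∀ i, ContMDiffAt I 𝓘(ℝ, ℝ) ∞ (fun x ↦ c x i) p := by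
    intro i
    refine ContMDiffAt.mul (hdet.inv₀ hdet0) ?_
    simp only [Matrix.cramer_apply]
    refine contMDiffAt_matrix_det fun k l ↦ ?_
    simp only [Matrix.updateCol_apply]
    split_ifs
    · exact hv k
    · exact hG k l
  have hsum : ContMDiffAt I I.tangent ∞
      (fun y ↦ (TotalSpace.mk' E y ((∑ i, c y i • s i y)) : TangentBundle I M)) p :=
    ContMDiffAt.sum_section (s := Finset.univ) (t := fun i y ↦ c y i • s i y)
      fun i _ ↦ (hc i).smul_section (hs i p)
  refine hsum.congr_of_eventuallyEq ?_
  filter_upwards [hdet.continuousAt.eventually_ne hdet0] with x hx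
  have hli : LinearIndependent ℝ (fun i ↦ s i x) := by
    rw [Fintype.linearIndependent_iff]
    intro g hg
    have : (G x).mulVec g = 0 := by
      ext j
      have := congrArg (fun z ↦ (inner ℝ (s j x) z : ℝ)) hg
      simp only [inner_sum, inner_smul_right, inner_zero_right] at this
      rw [Pi.zero_apply, ← this]
      simp [Matrix.mulVec, dotProduct, G, mul_comm]
    exact congrFun (Matrix.eq_zero_of_mulVec_eq_zero hx this)
  have htop := hli.span_eq_top_of_card_eq_finrank' (by
    rw [Fintype.card_fin]
    rfl)
  have horth : ∀ z ∈ Submodule.span ℝ (Set.range fun i ↦ s i x),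
      (inner ℝ z (X x - ∑ i, c x i • s i x) : ℝ) = 0 := by
    intro z hz
    induction hz using Submodule.span_induction with
    | mem z hz =>
      obtain ⟨j, rfl⟩ := hz
      have := congrFun (Matrix.mulVec_cramer (G x) (v x)) j
      simp only [Matrix.mulVec, dotProduct, Pi.smul_apply, smul_eq_mul] at this
      simp only [inner_sub_right, inner_sum, inner_smul_right]
      rw [real_inner_comm, sub_eq_zero]
      calc v x j = (G x).det⁻¹ * ((G x).det * v x j) := by field_simp
        _ = _ := by
          rw [← this, Finset.mul_sum]
          refine Finset.sum_congr rfl fun i _ ↦ ?_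
          simp only [c, G, Matrix.of_apply]
          ring
    | zero => simp
    | add a b _ _ ha hb => rw [inner_add_left, ha, hb, add_zero]
    | smul a b _ hb => rw [inner_smul_left, hb, mul_zero]
  have := horth (X x - ∑ i, c x i • s i x) (by rw [htop]; trivial)
  rw [inner_self_eq_zero, sub_eq_zero] at this
  simp only [this]

theorem IsLeviCivita.isSmoothField_covD [T2Space M] (hn : IsLeviCivita nabla)
    (hX : IsSmoothField I X) (hY : IsSmoothField I Y) : IsSmoothField I (covD nabla X Y) := by
  refine isSmoothField_of_inner fun Z hZ ↦ ?_
  simp only [hn.koszul hX hY hZ]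
  exact contMDiff_const.mul (((((contMDiff_mvfderiv_apply (hY.inner hZ) hX).add
    (contMDiff_mvfderiv_apply (hZ.inner hX) hY)).sub
    (contMDiff_mvfderiv_apply (hX.inner hY) hZ)).add ((hX.mlieBracket hY).inner hZ)).sub
    (hY.inner (hX.mlieBracket hZ)) |>.sub (hX.inner (hY.mlieBracket hZ)))

theorem IsLeviCivita.curvature_add_left [T2Space M] (hn : IsLeviCivita nabla)
    {X' : Π x : M, TangentSpace I x} (hX : IsSmoothField I X) (hX' : IsSmoothField I X')
    (hZ : IsSmoothField I Z) (Y : Π x : M, TangentSpace I x) (x : M) :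
    curvature nabla (X + X') Y Z x = curvature nabla X Y Z x + curvature nabla X' Y Z x := by
  simp only [curvature]
  rw [covD_add_left, covD_add_left,
    covD_add_right Y (hn.isSmoothField_covD hX hZ) (hn.isSmoothField_covD hX' hZ)]
  simp only [covD, Pi.add_apply]
  rw [VectorField.mlieBracket_add_left (hX.mdifferentiableAt x) (hX'.mdifferentiableAt x), map_add]
  abel

theorem IsLeviCivita.curvature_skew [T2Space M] (hn : IsLeviCivita nabla) (hX : IsSmoothField I X)
    (hY : IsSmoothField I Y) (hZ : IsSmoothField I Z) (hW : IsSmoothField I W) (x : M) :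
    inner ℝ (curvature nabla X Y Z x) (W x) = -inner ℝ (curvature nabla X Y W x) (Z x) := by
  have hc := mvfderiv_mlieBracket_apply (hZ.inner hW) hX hY x
  have key : ∀ {U V : Π x : M, TangentSpace I x}, IsSmoothField I U → IsSmoothField I V →
      mvfderiv I (fun y ↦ mvfderiv I (fun z ↦ (inner ℝ (Z z) (W z) : ℝ)) y (V y)) x (U x)
        = inner ℝ (covD nabla U (covD nabla V Z) x) (W x)
          + inner ℝ (covD nabla V Z x) (covD nabla U W x)
          + inner ℝ (covD nabla U Z x) (covD nabla V W x)
          + inner ℝ (Z x) (covD nabla U (covD nabla V W) x) := by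
    intro U V hU hV
    have hVZ := hn.isSmoothField_covD hV hZ
    have hVW := hn.isSmoothField_covD hV hW
    simp only [hn.mvfderiv_inner V hZ hW]
    rw [mvfderiv_fun_add ((hVZ.inner hW).contMDiffAt.mdifferentiableAt (by simp))
      ((hZ.inner hVW).contMDiffAt.mdifferentiableAt (by simp)), add_apply,
      hn.mvfderiv_inner U hVZ hW, hn.mvfderiv_inner U hZ hVW]
    ring
  rw [key hX hY, key hY hX, hn.mvfderiv_inner _ hZ hW] at hc
  simp only [curvature, inner_sub_left]
  rw [real_inner_comm (Z x), real_inner_comm (Z x), real_inner_comm (Z x)]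
  linarith

theorem IsLeviCivita.bianchi [T2Space M] (hn : IsLeviCivita nabla) (hX : IsSmoothField I X)
    (hY : IsSmoothField I Y) (hZ : IsSmoothField I Z) (x : M) :
    curvature nabla X Y Z x + curvature nabla Y Z X x + curvature nabla Z X Y x = 0 := by
  have key : ∀ {U V W : Π x : M, TangentSpace I x}, IsSmoothField I U → IsSmoothField I V →
      IsSmoothField I W → covD nabla U (covD nabla V W) x - covD nabla U (covD nabla W V) x
        - covD nabla (VectorField.mlieBracket I V W) U x
        = VectorField.mlieBracket I U (VectorField.mlieBracket I V W) x := by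
    intro U V W hU hV hW
    rw [← hn.covD_sub_covD hU (hV.mlieBracket hW), Pi.sub_apply, ← hn.covD_sub_covD hV hW,
      covD_sub_right U (hn.isSmoothField_covD hV hW) (hn.isSmoothField_covD hW hV), Pi.sub_apply]
  have j := leibniz_mlieBracket_apply hX hY hZ x
  rw [VectorField.mlieBracket_swap_apply (V := VectorField.mlieBracket I X Y),
    VectorField.mlieBracket_swap (V := X) (W := Z)] at j
  rw [← neg_one_smul ℝ (VectorField.mlieBracket I Z X),
    VectorField.mlieBracket_const_smul_right ((hZ.mlieBracket hX).mdifferentiableAt x),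
    ← key hX hY hZ, ← key hZ hX hY, ← key hY hZ hX] at j
  rw [← sub_eq_zero] at j
  rw [← j]
  simp only [curvature]
  module

end Riemannian

end ContactMetric

namespace ContactMetric

section AlmostContact

variable {E : Type*} [NormedAddCommGroup E] [NormedSpace ℝ E]
  {H : Type*} [TopologicalSpace H] {I : ModelWithCorners ℝ E H}
  {M : Type*} [TopologicalSpace M] [ChartedSpace H M] [IsManifold I ∞ M]
  [RiemannianBundle (fun x : M ↦ TangentSpace I x)]
  {φ : Π x : M, TangentSpace I x →L[ℝ] TangentSpace I x}
  {ξ : Π x : M, TangentSpace I x} {η : Π x : M, TangentSpace I x →L[ℝ] ℝ}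

namespace IsAlmostContactMetric

variable (hφ : IsAlmostContactMetric I φ ξ η)
include hφ

theorem phi_xi (x : M) : φ x (ξ x) = 0 := by
  have h1 : φ x (φ x (ξ x)) = 0 := by rw [hφ.phi_phi, hφ.eta_xi]; simp
  have h2 := hφ.phi_phi x (φ x (ξ x))
  rw [h1, map_zero] at h2
  have h3 : φ x (ξ x) = η x (φ x (ξ x)) • ξ x := by
    rw [eq_comm, neg_add_eq_zero] at h2; exact h2
  have h4 := congrArg (φ x) h3
  rw [h1, map_smul] at h4
  rcases smul_eq_zero.1 h4.symm with h | h
  · rw [h3, h, zero_smul]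
  · exact h

theorem xi_ne_zero (x : M) : ξ x ≠ 0 := fun h ↦ by
  have := hφ.eta_xi x
  rw [h, map_zero] at this
  exact zero_ne_one this

theorem eta_phi (x : M) (v : TangentSpace I x) : η x (φ x v) = 0 := by
  have h1 := hφ.phi_phi x (φ x v)
  rw [hφ.phi_phi x v, map_add, map_neg, map_smul, hφ.phi_xi, smul_zero, add_zero,
    left_eq_add] at h1
  exact (smul_eq_zero.1 h1).resolve_right (hφ.xi_ne_zero x)

theorem inner_xi (x : M) (v : TangentSpace I x) : inner ℝ (ξ x) v = η x v := by
  have := hφ.inner_phi_phi x (ξ x) v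
  rw [hφ.phi_xi, inner_zero_left, hφ.eta_xi] at this
  linarith

theorem inner_phi_left (x : M) (u v : TangentSpace I x) :
    inner ℝ (φ x u) v = -inner ℝ u (φ x v) := by
  have := hφ.inner_phi_phi x u (φ x v)
  rw [hφ.phi_phi x v, hφ.eta_phi, inner_add_right, inner_neg_right, inner_smul_right,
    real_inner_comm (ξ x), hφ.inner_xi, hφ.eta_phi] at this
  linarith

theorem isHorizontalField_phi {X : Π x : M, TangentSpace I x} (hX : IsSmoothField I X) :
    IsHorizontalField I η (fun x ↦ φ x (X x)) :=
  ⟨hX.apply_endomorphism hφ.smooth_phi, fun x ↦ hφ.eta_phi x _⟩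

theorem isHorizontalField_sub {X : Π x : M, TangentSpace I x} (hX : IsSmoothField I X) :
    IsHorizontalField I η (X - (fun x ↦ η x (X x)) • ξ) := by
  refine ⟨hX.sub (hφ.smooth_xi.smul (hX.apply_oneForm hφ.smooth_eta)), fun x ↦ ?_⟩
  simp [hφ.eta_xi]

/-- Horizontal vectors at a point extend linearly to smooth horizontal vector fields. -/
theorem exists_horizontal_extension [FiniteDimensional ℝ E] [T2Space M] (p : M) :
    ∃ e : TangentSpace I p →ₗ[ℝ] (Π x : M, TangentSpace I x),
      (∀ v, IsHorizontalField I η (e v)) ∧ ∀ v, η p v = 0 → e v p = v := by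
  obtain ⟨e, he, hep⟩ := exists_linear_extension (I := I) p
  refine ⟨{ toFun := fun v ↦ e v - (fun x ↦ η x (e v x)) • ξ
            map_add' := fun u v ↦ ?_
            map_smul' := fun c v ↦ ?_ }, fun v ↦ hφ.isHorizontalField_sub (he v), fun v hv ↦ ?_⟩
  · ext x
    simp only [map_add, Pi.add_apply, Pi.sub_apply, Pi.smul_apply']
    module
  · ext x
    simp only [map_smul, Pi.smul_apply, Pi.sub_apply, Pi.smul_apply', RingHom.id_apply,
      smul_eq_mul]
    module
  · simp [hep, hv]

end IsAlmostContactMetric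

variable [FiniteDimensional ℝ E]
  {nabla : CovariantDerivative I E (fun x : M ↦ TangentSpace I x)}
  {X Y Z W : Π x : M, TangentSpace I x}

section

variable (hφ : IsAlmostContactMetric I φ ξ η) (hn : IsLeviCivita nabla)
include hφ hn

theorem eta_covD_of_isHorizontalField (X : Π x : M, TangentSpace I x)
    (hY : IsHorizontalField I η Y) (x : M) :
    η x (covD nabla X Y x) = -inner ℝ (Y x) (covD nabla X ξ x) := by
  have h := hn.mvfderiv_inner X hφ.smooth_xi hY.1 x
  have h0 : (fun y ↦ (inner ℝ (ξ y) (Y y) : ℝ)) = fun _ ↦ 0 := by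
    ext y; rw [hφ.inner_xi, hY.2]
  rw [h0, mvfderiv_const, hφ.inner_xi, real_inner_comm] at h
  rw [zero_apply] at h
  linarith

theorem eta_covD_xi (X : Π x : M, TangentSpace I x) (x : M) : η x (covD nabla X ξ x) = 0 := by
  have h := hn.mvfderiv_inner X hφ.smooth_xi hφ.smooth_xi x
  have h0 : (fun y ↦ (inner ℝ (ξ y) (ξ y) : ℝ)) = fun _ ↦ 1 := by
    ext y; rw [hφ.inner_xi, hφ.eta_xi]
  rw [h0, mvfderiv_const, real_inner_comm, hφ.inner_xi] at h
  rw [zero_apply] at h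
  linarith

theorem extDerivOneForm_eq (hX : IsSmoothField I X) (hY : IsSmoothField I Y) (x : M) :
    extDerivOneForm I η X Y x
      = (1 / 2 : ℝ) * (inner ℝ (nabla ξ x (X x)) (Y x) - inner ℝ (nabla ξ x (Y x)) (X x)) := by
  simp only [extDerivOneForm, ← hφ.inner_xi]
  rw [hn.mvfderiv_inner X hφ.smooth_xi hY, hn.mvfderiv_inner Y hφ.smooth_xi hX,
    ← hn.covD_sub_covD hX hY, Pi.sub_apply, inner_sub_right]
  simp only [covD]
  ring

theorem eta_mlieBracket (hX : IsHorizontalField I η X) (hY : IsHorizontalField I η Y) (x : M) :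
    η x (VectorField.mlieBracket I X Y x)
      = inner ℝ (X x) (nabla ξ x (Y x)) - inner ℝ (Y x) (nabla ξ x (X x)) := by
  rw [← hn.covD_sub_covD hX.1 hY.1, Pi.sub_apply, map_sub,
    eta_covD_of_isHorizontalField hφ hn X hY, eta_covD_of_isHorizontalField hφ hn Y hX]
  simp only [covD]
  ring

end

/-- The tensor `φ` is parallel along `ker η`, up to the normal direction. -/
def IsHorizontallyParallel (nabla : CovariantDerivative I E (fun x : M ↦ TangentSpace I x))
    (φ : Π x : M, TangentSpace I x →L[ℝ] TangentSpace I x)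
    (η : Π x : M, TangentSpace I x →L[ℝ] ℝ) : Prop :=
  ∀ X Y Z : Π x : M, TangentSpace I x, IsHorizontalField I η X → IsHorizontalField I η Y →
    IsHorizontalField I η Z → ∀ x : M, inner ℝ (covDEndomorphism nabla φ X Y x) (Z x) = 0

variable [T2Space M] (hφ : IsAlmostContactMetric I φ ξ η)
  (hpar : IsHorizontallyParallel nabla φ η)
include hφ hpar

theorem covD_phi_eq (hX : IsHorizontalField I η X) (hY : IsHorizontalField I η Y) (x : M) :
    covD nabla X (fun y ↦ φ y (Y y)) x
      = φ x (covD nabla X Y x) + η x (covD nabla X (fun y ↦ φ y (Y y)) x) • ξ x := by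
  obtain ⟨e, he, hex⟩ := hφ.exists_horizontal_extension x
  obtain ⟨u, hu⟩ : ∃ u, u = covDEndomorphism nabla φ X Y x := ⟨_, rfl⟩
  have hηu : η x u = η x (covD nabla X (fun y ↦ φ y (Y y)) x) := by
    rw [hu, covDEndomorphism, map_sub, hφ.eta_phi, sub_zero]
  have hv : η x (u - η x u • ξ x) = 0 := by simp [hφ.eta_xi]
  have h := hpar X Y _ hX hY (he (u - η x u • ξ x)) x
  rw [hex _ hv, ← hu] at h
  have h2 : inner ℝ (u - η x u • ξ x) (u - η x u • ξ x) = (0 : ℝ) := by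
    rw [inner_sub_left, h, inner_smul_left, hφ.inner_xi, hv, mul_zero, sub_zero]
  rw [inner_self_eq_zero, sub_eq_zero] at h2
  rw [← hηu, ← h2, hu, covDEndomorphism]
  abel

variable [IsContMDiffRiemannianBundle I ∞ E (fun x : M ↦ TangentSpace I x)]
  (hn : IsLeviCivita nabla)
include hn

theorem inner_covD_covD_phi (hX : IsHorizontalField I η X) (hY : IsHorizontalField I η Y)
    (hZ : IsHorizontalField I η Z) (x : M) (w : TangentSpace I x) (hw : η x w = 0) :
    inner ℝ (covD nabla X (covD nabla Y (fun y ↦ φ y (Z y))) x) w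
      = inner ℝ (φ x (covD nabla X (covD nabla Y Z) x)) w
        + inner ℝ (Z x) (nabla ξ x (Y x)) * inner ℝ (φ x (nabla ξ x (X x))) w
        - inner ℝ (φ x (Z x)) (nabla ξ x (Y x)) * inner ℝ (nabla ξ x (X x)) w := by
  have hφZ := hφ.isHorizontalField_phi hZ.1
  have hD := hn.isSmoothField_covD hY.1 hZ.1
  have hD' := hn.isSmoothField_covD hY.1 hφZ.1
  have hU := hφ.isHorizontalField_sub hD
  have hτ := hD'.apply_oneForm hφ.smooth_eta
  have hβ := hD.apply_oneForm hφ.smooth_eta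
  obtain ⟨U, hUdef⟩ : ∃ U, U = covD nabla Y Z - (fun x ↦ η x (covD nabla Y Z x)) • ξ := ⟨_, rfl⟩
  rw [← hUdef] at hU
  have hξw : (inner ℝ (ξ x) w : ℝ) = 0 := by rw [hφ.inner_xi, hw]
  have e1 : covD nabla Y (fun y ↦ φ y (Z y)) = (fun y ↦ φ y (U y))
      + (fun y ↦ η y (covD nabla Y (fun z ↦ φ z (Z z)) y)) • ξ := by
    ext y
    simp only [Pi.add_apply, Pi.smul_apply', hUdef, Pi.sub_apply, map_sub, map_smul, hφ.phi_xi,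
      smul_zero, sub_zero]
    exact covD_phi_eq hφ hpar hY hZ y
  have e2 : covD nabla X (covD nabla Y (fun y ↦ φ y (Z y))) x
      = covD nabla X (fun y ↦ φ y (U y)) x
        + (η x (covD nabla Y (fun z ↦ φ z (Z z)) x) • covD nabla X ξ x
          + mvfderiv I (fun y ↦ η y (covD nabla Y (fun z ↦ φ z (Z z)) y)) x (X x) • ξ x) := by
    rw [e1, covD_add_right X (hφ.isHorizontalField_phi hU.1).1 (hφ.smooth_xi.smul hτ),
      Pi.add_apply, covD_smul_right X hτ hφ.smooth_xi, ← e1]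
  have e3 : covD nabla X U x = covD nabla X (covD nabla Y Z) x
      - (η x (covD nabla Y Z x) • covD nabla X ξ x
        + mvfderiv I (fun y ↦ η y (covD nabla Y Z y)) x (X x) • ξ x) := by
    rw [hUdef, covD_sub_right X hD (hφ.smooth_xi.smul hβ), Pi.sub_apply,
      covD_smul_right X hβ hφ.smooth_xi]
  rw [e2, covD_phi_eq hφ hpar hX hU, e3, eta_covD_of_isHorizontalField hφ hn Y hφZ,
    eta_covD_of_isHorizontalField hφ hn Y hZ]
  simp only [map_sub, map_add, map_smul, hφ.phi_xi, inner_add_left, inner_sub_left,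
    inner_smul_left, hξw, conj_trivial, inner_zero_left, covD]
  ring

/-- The horizontal part of the commutator of the curvature with `φ`. -/
theorem inner_curvature_phi_sub (hX : IsHorizontalField I η X) (hY : IsHorizontalField I η Y)
    (hZ : IsHorizontalField I η Z) (hW : IsHorizontalField I η W) (x : M) :
    inner ℝ (curvature nabla X Y (fun y ↦ φ y (Z y)) x) (W x)
        - inner ℝ (φ x (curvature nabla X Y Z x)) (W x)
      = inner ℝ (Z x) (nabla ξ x (Y x)) * inner ℝ (φ x (nabla ξ x (X x))) (W x)
        - inner ℝ (φ x (Z x)) (nabla ξ x (Y x)) * inner ℝ (nabla ξ x (X x)) (W x)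
        - inner ℝ (Z x) (nabla ξ x (X x)) * inner ℝ (φ x (nabla ξ x (Y x))) (W x)
        + inner ℝ (φ x (Z x)) (nabla ξ x (X x)) * inner ℝ (nabla ξ x (Y x)) (W x)
        - (inner ℝ (X x) (nabla ξ x (Y x)) - inner ℝ (Y x) (nabla ξ x (X x)))
          * inner ℝ (covDEndomorphism nabla φ ξ Z x) (W x) := by
  have hB := hφ.isHorizontalField_sub (hX.1.mlieBracket hY.1)
  have hV := hpar _ Z W hB hZ hW x
  rw [← eta_mlieBracket hφ hn hX hY]
  simp only [covDEndomorphism, covD, Pi.sub_apply, Pi.smul_apply', map_sub, map_smul,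
    inner_sub_left, inner_smul_left, conj_trivial] at hV ⊢
  simp only [curvature, inner_sub_left, map_sub]
  rw [inner_covD_covD_phi hφ hpar hn hX hY hZ x _ (hW.2 x),
    inner_covD_covD_phi hφ hpar hn hY hX hZ x _ (hW.2 x)]
  simp only [covD]
  linarith

end AlmostContact

end ContactMetric

namespace ContactMetric

section Flat

variable {E : Type*} [NormedAddCommGroup E] [NormedSpace ℝ E] [FiniteDimensional ℝ E]
  {H : Type*} [TopologicalSpace H] {I : ModelWithCorners ℝ E H}
  {M : Type*} [TopologicalSpace M] [T2Space M] [ChartedSpace H M] [IsManifold I ∞ M]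
  [RiemannianBundle (fun x : M ↦ TangentSpace I x)]
  [IsContMDiffRiemannianBundle I ∞ E (fun x : M ↦ TangentSpace I x)]
  {η : Π x : M, TangentSpace I x →L[ℝ] ℝ}
  {nabla : CovariantDerivative I E (fun x : M ↦ TangentSpace I x)}

theorem _root_.LinearIndependent.inner_mul_inner_sub_sq_ne_zero {V : Type*} [NormedAddCommGroup V]
    [InnerProductSpace ℝ V] {a b : V} (h : LinearIndependent ℝ ![a, b]) :
    (inner ℝ a a * inner ℝ b b - inner ℝ a b ^ 2 : ℝ) ≠ 0 := by
  intro h0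
  have ha : a ≠ 0 := h.ne_zero 0
  have hw : (inner ℝ a a : ℝ) • b + (-inner ℝ a b : ℝ) • a = 0 := by
    rw [← inner_self_eq_zero (𝕜 := ℝ)]
    simp only [inner_add_left, inner_add_right, inner_smul_left, inner_smul_right, conj_trivial,
      real_inner_comm a b]
    linear_combination (inner ℝ a a : ℝ) * h0
  have := (LinearIndependent.pair_iff.1 h (-inner ℝ a b) (inner ℝ a a)
    (by rw [add_comm]; exact hw)).2
  exact ha (inner_self_eq_zero.1 this)

theorem inner_curvature_eq_zero (hn : IsLeviCivita nabla) {p : M}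
    (hp : HorizontallyFlatAt nabla η p)
    (e : TangentSpace I p →ₗ[ℝ] (Π x : M, TangentSpace I x))
    (he : ∀ v, IsHorizontalField I η (e v)) (hep : ∀ v, η p v = 0 → e v p = v)
    {a b c d : TangentSpace I p} (ha : η p a = 0) (hb : η p b = 0) (hc : η p c = 0)
    (hd : η p d = 0) : inner ℝ (curvature nabla (e a) (e b) (e c) p) d = 0 := by
  let R := fun a b c d : LinearMap.ker (η p).toLinearMap ↦
    (inner ℝ (curvature nabla (e a) (e b) (e c) p) (d : TangentSpace I p) : ℝ)
  have hpt : ∀ a : LinearMap.ker (η p).toLinearMap, e a p = a := fun a ↦ hep _ a.2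
  have skew' : ∀ a b c d, R a b c d = -R a b d c := fun a b c d ↦ by
    have := hn.curvature_skew (he a).1 (he b).1 (he c).1 (he d).1 p
    rwa [hpt, hpt] at this
  refine eq_zero_of_curvature_symmetries R (fun a a' b c d ↦ ?_) (fun a b c d d' ↦ ?_)
    (fun a b c d ↦ ?_) skew' (fun a b c d ↦ ?_) (fun a b ↦ ?_) ⟨a, ha⟩ ⟨b, hb⟩ ⟨c, hc⟩ ⟨d, hd⟩
  · simp only [R, Submodule.coe_add, map_add]
    rw [hn.curvature_add_left (he a).1 (he a').1 (he c).1, inner_add_left]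
  · simp only [R, Submodule.coe_add, inner_add_right]
  · simp only [R]
    rw [curvature_swap, inner_neg_left]
  · simp only [R]
    rw [← inner_add_left, ← inner_add_left, hn.bianchi (he a).1 (he b).1 (he c).1, inner_zero_left]
  · by_cases ha0 : a = 0
    · simp [R, ha0]
    by_cases hli : LinearIndependent ℝ ![(a : TangentSpace I p), b]
    · have h := hp (e a) (e b) (he a).1 (he b).1 ((he a).2 p) ((he b).2 p)
        (by rwa [hpt, hpt])
      rw [sectionalCurvature, hpt, hpt, div_eq_zero_iff] at h
      exact h.resolve_right hli.inner_mul_inner_sub_sq_ne_zero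
    · rw [LinearIndependent.pair_iff' (by simpa using ha0)] at hli
      push Not at hli
      obtain ⟨t, ht⟩ := hli
      have hb : b = t • a := Subtype.ext ht.symm
      have h1 : R a b a b = t * R a b a a := by
        conv_lhs => rw [hb]
        simp only [R, hb, Submodule.coe_smul, inner_smul_right]
      have h2 := skew' a b a a
      rw [skew', h1, show R a b a a = 0 by linarith, mul_zero, neg_zero]

end Flat

end ContactMetric

/-- A contact form is nondegenerate on its kernel, at every point. -/
theorem eq_zero_of_isContactForm (n : ℕ) (hn : 1 ≤ n)
    {M : Type*} [TopologicalSpace M]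
    [ChartedSpace (EuclideanSpace ℝ (Fin (2 * n + 1))) M]
    [IsManifold (𝓡 (2 * n + 1)) ∞ M]
    [RiemannianBundle (fun x : M ↦ TangentSpace (𝓡 (2 * n + 1)) x)]
    {nabla : CovariantDerivative (𝓡 (2 * n + 1)) (EuclideanSpace ℝ (Fin (2 * n + 1)))
      (fun x : M ↦ TangentSpace (𝓡 (2 * n + 1)) x)}
    (hnabla : IsLeviCivita nabla)
    {φ : Π x : M, TangentSpace (𝓡 (2 * n + 1)) x →L[ℝ] TangentSpace (𝓡 (2 * n + 1)) x}
    {ξ : Π x : M, TangentSpace (𝓡 (2 * n + 1)) x}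
    {η : Π x : M, TangentSpace (𝓡 (2 * n + 1)) x →L[ℝ] ℝ}
    (hη : IsContactForm (𝓡 (2 * n + 1)) η n)
    (hφ : IsAlmostContactMetric (𝓡 (2 * n + 1)) φ ξ η) (p : M)
    (v : TangentSpace (𝓡 (2 * n + 1)) p) (hv : η p v = 0)
    (h : ∀ w, η p w = 0 → inner ℝ (nabla ξ p v) w - inner ℝ (nabla ξ p w) v = (0 : ℝ)) :
    v = 0 := by
  obtain ⟨X, hX, hne⟩ := hη.nonvanishing p
  have hfd : FiniteDimensional ℝ (TangentSpace (𝓡 (2 * n + 1)) p) :=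
    inferInstanceAs (FiniteDimensional ℝ (EuclideanSpace ℝ (Fin (2 * n + 1))))
  have hdim : Module.finrank ℝ (TangentSpace (𝓡 (2 * n + 1)) p) = 2 * n + 1 :=
    finrank_euclideanSpace_fin
  let B : TangentSpace (𝓡 (2 * n + 1)) p →ₗ[ℝ] TangentSpace (𝓡 (2 * n + 1)) p →ₗ[ℝ] ℝ :=
    (innerₗ (TangentSpace (𝓡 (2 * n + 1)) p)).comp (nabla ξ p).toLinearMap
  let Ω : TangentSpace (𝓡 (2 * n + 1)) p →ₗ[ℝ] TangentSpace (𝓡 (2 * n + 1)) p →ₗ[ℝ] ℝ :=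
    (1 / 2 : ℝ) • (B - B.flip)
  have hΩ : ∀ u w : TangentSpace (𝓡 (2 * n + 1)) p, Ω u w
      = (1 / 2 : ℝ) * (inner ℝ (nabla ξ p u) w - inner ℝ (nabla ξ p w) u) := fun u w ↦ rfl
  refine eq_zero_of_wedge_ne_zero n hdim (ξ p) ?_ Ω (fun i ↦ X i p) ?_ v ?_ ?_ ?_ hn
  · exact (hφ.inner_xi p _).trans (hφ.eta_xi p)
  · intro h0
    refine hne ?_
    rw [wedgeExtDerivPow, mul_eq_zero]
    right
    rw [← h0]
    refine Finset.sum_congr rfl fun σ _ ↦ ?_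
    rw [hφ.inner_xi]
    congr 2
    refine Finset.prod_congr rfl fun i _ ↦ ?_
    rw [hΩ, extDerivOneForm_eq hφ hnabla (hX _) (hX _)]
  · rw [hφ.inner_xi, hv]
  · intro w hw
    rw [hφ.inner_xi] at hw
    rw [hΩ, h w hw, mul_zero]
  · intro w hw
    rw [hφ.inner_xi] at hw
    rw [hΩ, ← neg_sub, h w hw, neg_zero, mul_zero]

theorem mainTheorem5 (n : ℕ) (hn : 1 ≤ n)
    {M : Type*} [TopologicalSpace M] [T2Space M]
    [ChartedSpace (EuclideanSpace ℝ (Fin (2 * n + 1))) M]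
    [IsManifold (𝓡 (2 * n + 1)) ∞ M]
    [RiemannianBundle (fun x : M ↦ TangentSpace (𝓡 (2 * n + 1)) x)]
    [IsContMDiffRiemannianBundle (𝓡 (2 * n + 1)) ∞ (EuclideanSpace ℝ (Fin (2 * n + 1)))
      (fun x : M ↦ TangentSpace (𝓡 (2 * n + 1)) x)]
    (nabla : CovariantDerivative (𝓡 (2 * n + 1)) (EuclideanSpace ℝ (Fin (2 * n + 1)))
      (fun x : M ↦ TangentSpace (𝓡 (2 * n + 1)) x))
    (hnabla : IsLeviCivita nabla)
    (φ : Π x : M, TangentSpace (𝓡 (2 * n + 1)) x →L[ℝ] TangentSpace (𝓡 (2 * n + 1)) x)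
    (ξ : Π x : M, TangentSpace (𝓡 (2 * n + 1)) x)
    (η : Π x : M, TangentSpace (𝓡 (2 * n + 1)) x →L[ℝ] ℝ)
    (hη : IsContactForm (𝓡 (2 * n + 1)) η n)
    (hφ : IsAlmostContactMetric (𝓡 (2 * n + 1)) φ ξ η)
    (hdη : ∀ X Y : Π x : M, TangentSpace (𝓡 (2 * n + 1)) x,
      IsHorizontalField (𝓡 (2 * n + 1)) η X → IsHorizontalField (𝓡 (2 * n + 1)) η Y →
      ∀ x : M, extDerivOneForm (𝓡 (2 * n + 1)) η (fun y ↦ φ y (X y)) (fun y ↦ φ y (Y y)) x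
        = -extDerivOneForm (𝓡 (2 * n + 1)) η X Y x)
    (hparallel : ∀ X Y Z : Π x : M, TangentSpace (𝓡 (2 * n + 1)) x,
      IsHorizontalField (𝓡 (2 * n + 1)) η X → IsHorizontalField (𝓡 (2 * n + 1)) η Y →
      IsHorizontalField (𝓡 (2 * n + 1)) η Z →
      ∀ x : M, inner ℝ (covDEndomorphism nabla φ X Y x) (Z x) = 0)
    (p : M) (hp : HorizontallyFlatAt nabla η p) :
    2 * n + 1 = 5 := by
  have hdim : Module.finrank ℝ (TangentSpace (𝓡 (2 * n + 1)) p) = 2 * n + 1 :=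
    finrank_euclideanSpace_fin
  have hfd : FiniteDimensional ℝ (TangentSpace (𝓡 (2 * n + 1)) p) :=
    inferInstanceAs (FiniteDimensional ℝ (EuclideanSpace ℝ (Fin (2 * n + 1))))
  obtain ⟨e, he, hep⟩ := hφ.exists_horizontal_extension p
  have h2 : n = 2 := by
    refine eq_two_of_gauss n hn hdim (ξ p) (hφ.xi_ne_zero p) (φ p).toLinearMap
      (nabla ξ p).toLinearMap (fun z ↦ covDEndomorphism nabla φ ξ (e z) p) ?_ ?_ ?_ ?_ ?_ ?_ ?_ ?_
    all_goals simp only [hφ.inner_xi, ContinuousLinearMap.coe_coe]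
    · intro v hv
      rw [hφ.phi_phi, hv, zero_smul, add_zero]
    · exact hφ.eta_phi p
    · intro u v hu
      rw [hφ.inner_phi_phi, hu, zero_mul, sub_zero]
    · exact hφ.inner_phi_left p
    · intro v hv
      have h := eta_covD_xi hφ hnabla (e v) p
      rwa [covD, hep v hv] at h
    · exact eq_zero_of_isContactForm n hn hnabla hη hφ p
    · intro u v hu hv
      have h := hdη _ _ (he u) (he v) p
      rw [extDerivOneForm_eq hφ hnabla (he u).1 (he v).1,
        extDerivOneForm_eq hφ hnabla (hφ.isHorizontalField_phi (he u).1).1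
          (hφ.isHorizontalField_phi (he v).1).1, hep u hu, hep v hv] at h
      linarith
    · intro x y z w hx hy hz hw
      have h := inner_curvature_phi_sub hφ hparallel hnabla (he x) (he y) (he z) (he w) p
      rw [hnabla.curvature_skew (he x).1 (he y).1 (hφ.isHorizontalField_phi (he z).1).1 (he w).1,
        hφ.inner_phi_left,
        inner_curvature_eq_zero hnabla hp e he hep hx hy hw (hφ.eta_phi p _),
        inner_curvature_eq_zero hnabla hp e he hep hx hy hz (hφ.eta_phi p _),
        hep x hx, hep y hy, hep z hz, hep w hw, neg_zero, sub_zero] at h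
      exact h.symm
  omega
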